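/- Let $(X,\mathcal B,\mu)$ be a probability space and $m$ a positive integer. Let $S$ be an $m$-transformation of $X$, i.e. a map assigning to each $x\in X$ a finite set $S(x)\subseteq X$ with $1\le |S(x)|\le m$. Suppose that $S$ is measurable, meaning that $\{x\in X: |S(x)|=k,\ |S(x)\cap B|=l\}\in\mathcal B$ for all $B\in\mathcal B$ and all integers $k,l\ge 0$, and that $S$ preserves $\mu$, meaning that $$\int_X \frac{|S(x)\cap B|}{|S(x)|}\,d\mu(x)=\mu(B)\qquad\text{for all } B\in\mathcal B.$$ For a function $f:X\to\mathbb R$ define $$Uf(x)=\frac1{|S(x)|}\sum_{y\in S(x)}f(y),\qquad A_n(f)=\frac1n\sum_{k=0}^{n-1}U^kf\quad(n\ge 1).$$ Then for every $f\in\mathcal L^1(\mu)$ there exists $f^*\in\mathcal L^1(\mu)$ such that $A_n(f)\to f^*$ $\mu$-a.e. as $n\to\infty$. Furthermore, $Uf^*=f^*$ $\mu$-a.e. and $\int_X f^*\,d\mu=\int_X f\,d\mu$. -/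

import Mathlib

open MeasureTheory Filter Topology
open scoped ENNReal

noncomputable section

namespace MTransf

variable {X : Type*}

/-- A multivalued transformation with finite images is an `m`-transformation if every image has
at least one and at most `m` elements. -/
def IsMTransformation (m : ℕ) (S : X → Finset X) : Prop :=
  ∀ x, 1 ≤ (S x).card ∧ (S x).card ≤ m

/-- `S⁻¹_{k;l}(B)`: the points whose image has exactly `k` elements, exactly `l` of them
in `B`. -/
def preimageKL (S : X → Finset X) (k l : ℕ) (B : Set X) : Set X :=
  {x | (S x).card = k ∧ ((S x : Set X) ∩ B).ncard = l}

/-- Measurability of a multivalued transformation: all sets `S⁻¹_{k;l}(B)` with `B` measurable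
are measurable. -/
def IsMeasurable [MeasurableSpace X] (S : X → Finset X) : Prop :=
  ∀ B : Set X, MeasurableSet B → ∀ k l : ℕ, MeasurableSet (preimageKL S k l B)

/-- The measure `K(x, ·)`, the uniform distribution on the finite set `S x`. -/
def stochKernel [MeasurableSpace X] (S : X → Finset X) (x : X) : Measure X :=
  ((S x).card : ℝ≥0∞)⁻¹ • ∑ y ∈ S x, Measure.dirac y

/-- The measure `S μ`, with `S μ (B) = ∫ K(x, B) dμ(x)` (see `pushMeasure_apply`). -/
def pushMeasure [MeasurableSpace X] (S : X → Finset X) (μ : Measure X) : Measure X :=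
  μ.bind (stochKernel S)

/-- `S` preserves `μ` if `S` is measurable and `S μ = μ`. -/
structure PreservesMeasure [MeasurableSpace X] (S : X → Finset X) (μ : Measure X) : Prop where
  isMeasurable : IsMeasurable S
  pushMeasure_eq : pushMeasure S μ = μ

/-- The averaging operator `(U f)(x) = (1 / |S x|) ∑_{y ∈ S x} f y`. -/
def koopman (S : X → Finset X) (f : X → ℝ) : X → ℝ :=
  fun x => (1 / ((S x).card : ℝ)) * ∑ y ∈ S x, f y

/-- The averages `A_n(f) = (1 / n) ∑_{k < n} U ^ k f`, for `n ≥ 1`. -/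
def average (S : X → Finset X) (n : ℕ) (f : X → ℝ) : X → ℝ :=
  fun x => (1 / (n : ℝ)) * ∑ k ∈ Finset.range n, ((koopman S)^[k] f) x

theorem stochKernel_apply [MeasurableSpace X] (S : X → Finset X) (x : X) {B : Set X}
    (hB : MeasurableSet B) :
    stochKernel S x B = ((S x).card : ℝ≥0∞)⁻¹ * (((S x : Set X) ∩ B).ncard : ℝ≥0∞) := by
  classical
  have h : ((S x : Set X) ∩ B) = ((S x).filter (· ∈ B) : Finset X) := by
    ext y; simp
  rw [h, Set.ncard_coe_finset]
  simp [stochKernel, hB, Set.indicator_apply, Finset.sum_ite]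

theorem measurable_stochKernel [MeasurableSpace X] {S : X → Finset X} (hS : IsMeasurable S) :
    Measurable (stochKernel S) := by
  refine Measure.measurable_of_measurable_coe _ fun B hB => ?_
  have h : Measurable fun x => ((S x).card, ((S x : Set X) ∩ B).ncard) := by
    refine measurable_to_countable' fun p => ?_
    have : (fun x => ((S x).card, ((S x : Set X) ∩ B).ncard)) ⁻¹' {p}
        = preimageKL S p.1 p.2 B := by
      ext x; simp [preimageKL, Prod.ext_iff]
    rw [this]
    exact hS B hB _ _
  have h2 : Measurable fun p : ℕ × ℕ => ((p.1 : ℝ≥0∞)⁻¹ * (p.2 : ℝ≥0∞)) :=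
    measurable_of_countable _
  simpa only [stochKernel_apply S _ hB, Function.comp_def] using h2.comp h

theorem pushMeasure_apply [MeasurableSpace X] {S : X → Finset X} (hS : IsMeasurable S)
    (μ : Measure X) {B : Set X} (hB : MeasurableSet B) :
    pushMeasure S μ B = ∫⁻ x, stochKernel S x B ∂μ :=
  Measure.bind_apply hB (measurable_stochKernel hS).aemeasurable

end MTransf

end

open MeasureTheory Filter Topology
open scoped ENNReal

/-! `koopman S` is a positive operator U fixing constants and preserving integrals, so the
Hopf–Garsia maximal inequality holds for it. For integrable f ≥ 0 let h be the liminf of the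
averages. Fatou gives ∫h ≤ ∫f; finiteness of the images gives Uh ≤ h, hence Uh = h a.e. because the
integrals agree. The maximal inequality for h + ε - f then gives ∫f ≤ ∫h + ε, so ∫h = ∫f
(`exists_isLiminf`). If f ≤ c, the same applied to c - f shows that the limsup also has integral ∫f,
so it equals the liminf a.e. An unbounded f is truncated, the remainder being controlled by the
weak-type inequality; a signed f splits into positive and negative parts. -/

namespace MTransf

variable {X : Type*}

/-! ### Algebra and positivity of the averaging operator. -/

section Algebra

/-- The averaging operator as a linear endomorphism of the space of real functions. -/
noncomputable def koopmanLinear (S : X → Finset X) : (X → ℝ) →ₗ[ℝ] (X → ℝ) where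
  toFun := koopman S
  map_add' f g := by
    funext x
    simp [koopman, Finset.sum_add_distrib, mul_add]
  map_smul' c f := by
    funext x
    simp only [koopman, Pi.smul_apply, smul_eq_mul, RingHom.id_apply, ← Finset.mul_sum]
    ring

@[simp]
theorem koopmanLinear_apply (S : X → Finset X) (f : X → ℝ) : koopmanLinear S f = koopman S f := rfl

/-- The ergodic sum `f + U f + ⋯ + U ^ (n - 1) f`, linear in `f`. -/
noncomputable def ergodicSum (S : X → Finset X) (n : ℕ) : (X → ℝ) →ₗ[ℝ] (X → ℝ) :=
  ∑ k ∈ Finset.range n, koopmanLinear S ^ k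

theorem average_eq_ergodicSum (S : X → Finset X) (n : ℕ) (f : X → ℝ) (x : X) :
    average S n f x = ergodicSum S n f x / n := by
  simp only [average, ergodicSum, LinearMap.sum_apply, Finset.sum_apply, Module.End.pow_apply]
  rw [one_div, inv_mul_eq_div]
  rfl

@[simp]
theorem ergodicSum_zero (S : X → Finset X) (f : X → ℝ) : ergodicSum S 0 f = 0 := by
  simp [ergodicSum]

theorem ergodicSum_succ (S : X → Finset X) (n : ℕ) (f : X → ℝ) :
    ergodicSum S (n + 1) f = f + koopman S (ergodicSum S n f) := by
  rw [← koopmanLinear_apply, ergodicSum, Finset.sum_range_succ', add_comm]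
  simp [ergodicSum, LinearMap.sum_apply, map_sum, pow_succ']

theorem koopman_mono (S : X → Finset X) {f g : X → ℝ} {x : X} (h : ∀ y ∈ S x, f y ≤ g y) :
    koopman S f x ≤ koopman S g x :=
  mul_le_mul_of_nonneg_left (Finset.sum_le_sum h) (by positivity)

theorem koopman_congr (S : X → Finset X) {f g : X → ℝ} {x : X} (h : ∀ y ∈ S x, f y = g y) :
    koopman S f x = koopman S g x := by
  rw [koopman, koopman, Finset.sum_congr rfl h]

theorem koopman_sub (S : X → Finset X) (f g : X → ℝ) :
    koopman S (f - g) = koopman S f - koopman S g := map_sub (koopmanLinear S) f g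

theorem koopman_const {m : ℕ} {S : X → Finset X} (hS : IsMTransformation m S) (c : ℝ) :
    koopman S (fun _ => c) = fun _ => c := by
  funext x
  have : ((S x).card : ℝ) ≠ 0 := by
    have := (hS x).1
    positivity
  simp [koopman, this]

theorem ergodicSum_const {m : ℕ} {S : X → Finset X} (hS : IsMTransformation m S) (n : ℕ) (c : ℝ) :
    ergodicSum S n (fun _ => c) = fun _ => n * c := by
  induction n with
  | zero => funext x; simp
  | succ n ih =>
    rw [ergodicSum_succ, ih, koopman_const hS]
    funext x
    simp
    ring

theorem ergodicSum_mono (S : X → Finset X) (n : ℕ) {f g : X → ℝ} (h : f ≤ g) :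
    ergodicSum S n f ≤ ergodicSum S n g := by
  induction n with
  | zero => simp
  | succ n ih =>
    rw [ergodicSum_succ, ergodicSum_succ]
    exact fun x => add_le_add (h x) (koopman_mono S fun y _ => ih y)

theorem average_mono (S : X → Finset X) (n : ℕ) {f g : X → ℝ} (h : f ≤ g) (x : X) :
    average S n f x ≤ average S n g x := by
  rw [average_eq_ergodicSum, average_eq_ergodicSum]
  exact div_le_div_of_nonneg_right (ergodicSum_mono S n h x) (Nat.cast_nonneg n)

theorem average_nonneg (S : X → Finset X) (n : ℕ) {f : X → ℝ} (h : 0 ≤ f) (x : X) :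
    0 ≤ average S n f x := by
  have := average_mono S n h x
  rwa [average_eq_ergodicSum S n 0, map_zero, Pi.zero_apply, zero_div] at this

theorem average_sub (S : X → Finset X) (n : ℕ) (f g : X → ℝ) (x : X) :
    average S n (f - g) x = average S n f x - average S n g x := by
  simp only [average_eq_ergodicSum, map_sub, Pi.sub_apply, sub_div]

theorem average_const {m : ℕ} {S : X → Finset X} (hS : IsMTransformation m S) {n : ℕ} (hn : 0 < n)
    (c : ℝ) (x : X) : average S n (fun _ => c) x = c := by
  rw [average_eq_ergodicSum, ergodicSum_const hS]
  field_simp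

end Algebra

/-! ### Null sets and the Markov kernel. -/

section Invariance

variable [MeasurableSpace X] {μ : Measure X} {S : X → Finset X}

/-- A null set B satisfies ∫ K(x, B) dμ = μ(B) = 0, so almost no image meets it. Hence U respects
a.e. equality although it is defined pointwise. -/
theorem PreservesMeasure.ae_forall_mem (hpres : PreservesMeasure S μ) {p : X → Prop}
    (hp : ∀ᵐ x ∂μ, p x) :
    ∀ᵐ x ∂μ, ∀ y ∈ S x, p y := by
  obtain ⟨B, hpB, hB, hB0⟩ := exists_measurable_superset_of_null (ae_iff.1 hp)
  have hmeas : Measurable fun x => stochKernel S x B :=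
    (Measure.measurable_coe hB).comp (measurable_stochKernel hpres.isMeasurable)
  rw [← hpres.pushMeasure_eq, pushMeasure_apply hpres.isMeasurable μ hB,
    lintegral_eq_zero_iff hmeas] at hB0
  filter_upwards [hB0] with x hx y hy
  by_contra hpy
  rw [stochKernel_apply S x hB] at hx
  simp only [Pi.zero_apply, mul_eq_zero, ENNReal.inv_eq_zero, ENNReal.natCast_ne_top, false_or,
    Nat.cast_eq_zero] at hx
  rw [Set.ncard_eq_zero ((S x).finite_toSet.inter_of_left B)] at hx
  exact Set.notMem_empty y (hx ▸ ⟨hy, hpB hpy⟩)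

theorem PreservesMeasure.koopman_congr_ae (hpres : PreservesMeasure S μ) {f g : X → ℝ}
    (h : f =ᵐ[μ] g) :
    koopman S f =ᵐ[μ] koopman S g := by
  filter_upwards [hpres.ae_forall_mem h] with x hx using koopman_congr S hx

theorem koopman_eq_integral (S : X → Finset X) {f : X → ℝ} (hf : StronglyMeasurable f) (x : X) :
    koopman S f x = ∫ y, f y ∂(stochKernel S x) := by
  rw [stochKernel, integral_smul_measure, integral_finsetSum_measure]
  · simp [koopman, integral_dirac' _ _ hf]
  · intro y _
    exact integrable_dirac' hf (by simp)

/-- The uniform distributions on the images, as a kernel. -/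
noncomputable def imageKernel (hmeas : IsMeasurable S) : ProbabilityTheory.Kernel X X :=
  ⟨stochKernel S, measurable_stochKernel hmeas⟩

theorem isMarkovKernel_imageKernel {m : ℕ} (hS : IsMTransformation m S) (hmeas : IsMeasurable S) :
    ProbabilityTheory.IsMarkovKernel (imageKernel hmeas) := by
  refine ⟨fun x => ⟨?_⟩⟩
  change stochKernel S x Set.univ = 1
  rw [stochKernel_apply S x MeasurableSet.univ, Set.inter_univ, Set.ncard_coe_finset]
  have := (hS x).1
  exact ENNReal.inv_mul_cancel (by simp; rintro h; simp [h] at this) (by simp)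

end Invariance

/-! ### Integrability and invariance of integrals. -/

section Integrals

variable [MeasurableSpace X] {μ : Measure X} {S : X → Finset X} {m : ℕ}

/-- Integration against Dirac masses is evaluation for strongly measurable functions, so both sides
are compared through such a representative of f. -/
theorem PreservesMeasure.koopman_ae_eq_integral (hpres : PreservesMeasure S μ) {f : X → ℝ}
    (hf : Integrable f μ) :
    koopman S f =ᵐ[μ] fun x => ∫ y, f y ∂(imageKernel hpres.isMeasurable x) := by
  have hbind : μ.bind (imageKernel hpres.isMeasurable) = μ := hpres.pushMeasure_eq
  have h1 : ∀ᵐ x ∂(μ.bind (imageKernel hpres.isMeasurable)), f x = hf.1.mk f x :=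
    hbind.symm ▸ hf.1.ae_eq_mk
  filter_upwards [hpres.koopman_congr_ae hf.1.ae_eq_mk, Measure.ae_ae_of_ae_comp h1]
    with x hx hx'
  rw [hx, koopman_eq_integral S hf.1.stronglyMeasurable_mk]
  exact (integral_congr_ae hx').symm

theorem PreservesMeasure.integrable_koopman (hpres : PreservesMeasure S μ)
    (hS : IsMTransformation m S) {f : X → ℝ} (hf : Integrable f μ) :
    Integrable (koopman S f) μ := by
  have := isMarkovKernel_imageKernel hS hpres.isMeasurable
  have hbind : μ.bind (imageKernel hpres.isMeasurable) = μ := hpres.pushMeasure_eq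
  have hf' : Integrable f (μ.bind (imageKernel hpres.isMeasurable)) := hbind.symm ▸ hf
  -- Viewing μ as a constant kernel makes the integration rules for composed kernels applicable.
  rw [Measure.comp_eq_comp_const_apply] at hf'
  refine Integrable.congr ?_ (hpres.koopman_ae_eq_integral hf).symm
  simpa using hf'.integral_comp

theorem PreservesMeasure.integral_koopman (hpres : PreservesMeasure S μ)
    {f : X → ℝ} (hf : Integrable f μ) :
    ∫ x, koopman S f x ∂μ = ∫ x, f x ∂μ := by
  have hbind : μ.bind (imageKernel hpres.isMeasurable) = μ := hpres.pushMeasure_eq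
  have hf' : Integrable f (μ.bind (imageKernel hpres.isMeasurable)) := hbind.symm ▸ hf
  rw [integral_congr_ae (hpres.koopman_ae_eq_integral hf)]
  rw [Measure.comp_eq_comp_const_apply] at hf' hbind
  have h := ProbabilityTheory.Kernel.integral_comp hf'
  rw [hbind] at h
  simpa using h.symm

theorem PreservesMeasure.integrable_ergodicSum (hpres : PreservesMeasure S μ)
    (hS : IsMTransformation m S) {f : X → ℝ} (hf : Integrable f μ) (n : ℕ) :
    Integrable (ergodicSum S n f) μ := by
  induction n with
  | zero => simp
  | succ n ih =>
    rw [ergodicSum_succ]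
    exact hf.add (hpres.integrable_koopman hS ih)

theorem PreservesMeasure.integral_ergodicSum (hpres : PreservesMeasure S μ)
    (hS : IsMTransformation m S) {f : X → ℝ} (hf : Integrable f μ) (n : ℕ) :
    ∫ x, ergodicSum S n f x ∂μ = n * ∫ x, f x ∂μ := by
  induction n with
  | zero => simp
  | succ n ih =>
    have hn := hpres.integrable_ergodicSum hS hf n
    rw [ergodicSum_succ, integral_add' hf (hpres.integrable_koopman hS hn),
      hpres.integral_koopman hn, ih]
    push_cast
    ring

theorem PreservesMeasure.integrable_average (hpres : PreservesMeasure S μ)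
    (hS : IsMTransformation m S) {f : X → ℝ} (hf : Integrable f μ) (n : ℕ) :
    Integrable (average S n f) μ := by
  refine ((hpres.integrable_ergodicSum hS hf n).div_const n).congr (ae_of_all _ fun x => ?_)
  exact (average_eq_ergodicSum S n f x).symm

theorem PreservesMeasure.integral_average (hpres : PreservesMeasure S μ)
    (hS : IsMTransformation m S) {f : X → ℝ} (hf : Integrable f μ) {n : ℕ} (hn : 0 < n) :
    ∫ x, average S n f x ∂μ = ∫ x, f x ∂μ := by
  simp only [average_eq_ergodicSum]
  rw [integral_div, hpres.integral_ergodicSum hS hf]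
  field_simp

end Integrals

/-! ### Maximal inequalities. -/

section Maximal

theorem setOf_exists_ergodicSum_pos (S : X → Finset X) (g : X → ℝ) :
    {x | ∃ n, 0 < ergodicSum S n g x} =
      ⋃ n, {x | 0 < partialSups (fun k => ergodicSum S k g) n x} := by
  ext x
  simp only [Set.mem_ofPred_eq, Set.mem_iUnion]
  constructor
  · rintro ⟨n, hn⟩
    exact ⟨n, hn.trans_le (le_partialSups (fun k => ergodicSum S k g) n x)⟩
  · rintro ⟨n, hn⟩
    by_contra! h
    refine hn.not_ge ?_
    rw [Pi.partialSups_apply]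
    exact partialSups_le _ _ _ fun k _ => h k

variable [MeasurableSpace X] {μ : Measure X} {S : X → Finset X} {m : ℕ}

/-- The Hopf–Garsia inequality at a finite horizon. -/
theorem PreservesMeasure.setIntegral_partialSups_pos_nonneg (hpres : PreservesMeasure S μ)
    (hS : IsMTransformation m S) {g : X → ℝ} (hg : Integrable g μ) (n : ℕ) :
    NullMeasurableSet {x | 0 < partialSups (fun k => ergodicSum S k g) n x} μ ∧
      0 ≤ ∫ x in {x | 0 < partialSups (fun k => ergodicSum S k g) n x}, g x ∂μ := by
  set M : X → ℝ := partialSups (fun k => ergodicSum S k g) n with hM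
  have hMint : Integrable M μ := by
    rw [hM]
    clear hM
    induction n with
    | zero => simp
    | succ n ih =>
      rw [partialSups_add_one]
      exact ih.sup (hpres.integrable_ergodicSum hS hg _)
  -- The empty sum, k = 0, is among the terms of the maximum.
  have hM0 : 0 ≤ M := by
    have := le_partialSups_of_le (fun k => ergodicSum S k g) (Nat.zero_le n)
    simpa using this
  have hPM0 : ∀ x, 0 ≤ koopman S M x := fun x => by
    have := koopman_mono S (f := 0) (g := M) (x := x) fun y _ => hM0 y
    simpa [koopman] using this
  have hle : M ≤ 0 ⊔ (g + koopman S M) := by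
    refine partialSups_le _ _ _ fun k hk => ?_
    cases k with
    | zero => simp
    | succ k =>
      rw [ergodicSum_succ]
      refine le_sup_of_le_right (add_le_add le_rfl fun x => koopman_mono S fun y _ => ?_)
      exact le_partialSups_of_le (fun k => ergodicSum S k g) (by omega : k ≤ n) y
  have hE : NullMeasurableSet {x | 0 < M x} μ :=
    nullMeasurableSet_lt aemeasurable_const hMint.1.aemeasurable
  have hPM := hpres.integrable_koopman hS hMint
  refine ⟨hE, ?_⟩
  rw [← integral_indicator₀ hE]
  -- M - UM has integral zero and lies below g on {M > 0} by `hle`; elsewhere M = 0 and UM ≥ 0, so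
  -- it lies below 0.
  calc (0 : ℝ) = ∫ x, (M - koopman S M) x ∂μ := by
        rw [integral_sub' hMint hPM, hpres.integral_koopman hMint, sub_self]
    _ ≤ _ := by
        refine integral_mono (hMint.sub hPM) (hg.indicator₀ hE) fun x => ?_
        by_cases hx : 0 < M x
        · have := hle x
          simp only [Pi.sup_apply, Pi.zero_apply, Pi.add_apply, le_sup_iff] at this
          rw [Set.indicator_of_mem (by exact hx)]
          simp only [Pi.sub_apply]
          rcases this with h | h <;> linarith
        · rw [Set.indicator_of_notMem (by exact hx)]
          simp only [Pi.sub_apply]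
          linarith [hPM0 x]

/-- The maximal ergodic theorem. -/
theorem PreservesMeasure.setIntegral_exists_ergodicSum_pos_nonneg (hpres : PreservesMeasure S μ)
    (hS : IsMTransformation m S) {g : X → ℝ} (hg : Integrable g μ) :
    0 ≤ ∫ x in {x | ∃ n, 0 < ergodicSum S n g x}, g x ∂μ := by
  rw [setOf_exists_ergodicSum_pos]
  refine ge_of_tendsto' (tendsto_setIntegral_of_monotone₀
    (fun n => (hpres.setIntegral_partialSups_pos_nonneg hS hg n).1) ?_ hg.integrableOn)
    fun n => (hpres.setIntegral_partialSups_pos_nonneg hS hg n).2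
  intro i j hij x hx
  exact lt_of_lt_of_le (α := ℝ) hx ((partialSups (fun k => ergodicSum S k g)).monotone hij x)

/-- The weak-type maximal inequality for the ergodic averages of a nonnegative function. -/
theorem PreservesMeasure.mul_measureReal_exists_average_gt_le [IsProbabilityMeasure μ]
    (hpres : PreservesMeasure S μ) (hS : IsMTransformation m S) {r : X → ℝ} (hr : Integrable r μ)
    (hr0 : 0 ≤ r) (c : ℝ) :
    c * μ.real {x | ∃ n, 0 < n ∧ c < average S n r x} ≤ ∫ x, r x ∂μ := by
  -- An average of r exceeds c exactly when the ergodic sum of r - c is positive; n = 0 contributes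
  -- to neither side.
  have hset : {x | ∃ n, 0 < n ∧ c < average S n r x} =
      {x | ∃ n, 0 < ergodicSum S n (r - fun _ => c) x} := by
    ext x
    refine exists_congr fun n => ?_
    rcases Nat.eq_zero_or_pos n with rfl | hn
    · simp
    · have hn' : (0 : ℝ) < n := by exact_mod_cast hn
      simp only [hn, true_and, average_eq_ergodicSum, map_sub, ergodicSum_const hS, Pi.sub_apply,
        sub_pos, lt_div_iff₀ hn', mul_comm c]
  have hg : Integrable (r - fun _ => c) μ := hr.sub (integrable_const c)
  have h := hpres.setIntegral_exists_ergodicSum_pos_nonneg hS hg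
  rw [← hset, integral_sub' hr.integrableOn (integrable_const c).integrableOn,
    setIntegral_const, smul_eq_mul] at h
  have := setIntegral_le_integral (s := {x | ∃ n, 0 < n ∧ c < average S n r x}) hr
    (ae_of_all _ hr0)
  linarith

end Maximal


/-! ### The inferior limit of the averages. -/

section Liminf

/-- A characterization of the inferior limit `l` of a sequence of reals that is bounded below and
has finite inferior limit. -/
def IsLiminf (u : ℕ → ℝ) (l : ℝ) : Prop :=
  ∀ ε > 0, (∀ᶠ n in atTop, l - ε < u n) ∧ ∃ᶠ n in atTop, u n < l + ε

theorem isLiminf_toReal_liminf_ofReal {u : ℕ → ℝ} (hu : ∀ n, 0 ≤ u n)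
    (hfin : liminf (fun n => ENNReal.ofReal (u n)) atTop ≠ ∞) :
    IsLiminf u (liminf (fun n => ENNReal.ofReal (u n)) atTop).toReal := by
  set L := liminf (fun n => ENNReal.ofReal (u n)) atTop with hL
  intro ε hε
  constructor
  · by_cases hneg : L.toReal - ε < 0
    · exact Eventually.of_forall fun n => hneg.trans_le (hu n)
    · have h : ENNReal.ofReal (L.toReal - ε) < L := by
        rw [ENNReal.ofReal_lt_iff_lt_toReal (not_lt.1 hneg) hfin]
        linarith
      filter_upwards [eventually_lt_of_lt_liminf h] with n hn
      exact (ENNReal.ofReal_lt_ofReal_iff_of_nonneg (not_lt.1 hneg)).1 hn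
  · have h : L < ENNReal.ofReal (L.toReal + ε) := by
      rw [ENNReal.lt_ofReal_iff_toReal_lt hfin]
      linarith
    refine (frequently_lt_of_liminf_lt (by isBoundedDefault) h).mono fun n hn => ?_
    exact (ENNReal.ofReal_lt_ofReal_iff_of_nonneg (hu n)).1 hn

/-- The relation between `U (A_n f)` and `A_{n+1} f`. -/
theorem koopman_average (S : X → Finset X) {n : ℕ} (hn : 0 < n) (f : X → ℝ) (x : X) :
    koopman S (average S n f) x = average S (n + 1) f x + (average S (n + 1) f x - f x) / n := by
  have h1 : average S n f = (n : ℝ)⁻¹ • ergodicSum S n f := by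
    funext y
    rw [average_eq_ergodicSum, Pi.smul_apply, smul_eq_mul, inv_mul_eq_div]
  rw [h1, ← koopmanLinear_apply, map_smul, average_eq_ergodicSum, ergodicSum_succ]
  simp only [koopmanLinear_apply, Pi.smul_apply, smul_eq_mul, Pi.add_apply]
  push_cast
  field_simp
  ring

/-- Since S x is finite, the lower bounds at its points hold simultaneously for large n. By
`koopman_average`, U (A_n f) x is close to A_{n+1} f x along those n for which the latter is near h
x. -/
theorem koopman_le_of_isLiminf {m : ℕ} {S : X → Finset X} (hS : IsMTransformation m S)
    {f h : X → ℝ} {x : X} (hx : IsLiminf (fun n => average S n f x) (h x))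
    (hSx : ∀ y ∈ S x, IsLiminf (fun n => average S n f y) (h y)) :
    koopman S h x ≤ h x := by
  refine le_of_forall_pos_le_add fun ε hε => ?_
  have h1 : ∀ᶠ n in atTop, koopman S h x - ε / 3 ≤ koopman S (average S n f) x := by
    have : ∀ᶠ n in atTop, ∀ y ∈ S x, h y - ε / 3 < average S n f y :=
      (Filter.eventually_all_finset (S x)).2 fun y hy => (hSx y hy _ (by positivity)).1
    filter_upwards [this] with n hn
    have := koopman_mono S (f := h - fun _ => ε / 3) (g := average S n f) (x := x)
      fun y hy => (hn y hy).le
    rwa [koopman_sub, koopman_const hS] at this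
  have h2 : ∀ᶠ n : ℕ in atTop, (h x + ε / 3 - f x) / n < ε / 3 :=
    (tendsto_const_div_atTop_nhds_zero_nat _).eventually_lt_const (by positivity)
  have h3 : ∃ᶠ n in atTop, average S (n + 1) f x < h x + ε / 3 := by
    have := (hx (ε / 3) (by positivity)).2
    rw [← Filter.map_add_atTop_eq_nat 1, Filter.frequently_map] at this
    exact this
  obtain ⟨n, h3n, h1n, h2n, hn⟩ :=
    (h3.and_eventually (h1.and (h2.and (eventually_gt_atTop 0)))).exists
  rw [koopman_average S hn] at h1n
  have : (average S (n + 1) f x - f x) / n ≤ (h x + ε / 3 - f x) / n := by gcongr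
  linarith

variable [MeasurableSpace X] {μ : Measure X} {S : X → Finset X} {m : ℕ}

theorem PreservesMeasure.exists_isLiminf_integral_le (hpres : PreservesMeasure S μ)
    (hS : IsMTransformation m S) {f : X → ℝ} (hf : Integrable f μ) (hf0 : 0 ≤ f) :
    ∃ h : X → ℝ, Integrable h μ ∧ ∫ x, h x ∂μ ≤ ∫ x, f x ∂μ ∧
      ∀ᵐ x ∂μ, IsLiminf (fun n => average S n f x) (h x) := by
  set F : X → ℝ≥0∞ := fun x => liminf (fun n => ENNReal.ofReal (average S n f x)) atTop with hF
  have hmeas : ∀ n, AEMeasurable (fun x => ENNReal.ofReal (average S n f x)) μ := fun n =>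
    (hpres.integrable_average hS hf n).1.aemeasurable.ennreal_ofReal
  have hFm : AEMeasurable F μ := by
    refine ⟨_, Measurable.liminf fun n => (hmeas n).measurable_mk, ?_⟩
    filter_upwards [ae_all_iff.2 fun n => (hmeas n).ae_eq_mk] with x hx
    simp only [hF, hx]
  have hle : ∫⁻ x, F x ∂μ ≤ ENNReal.ofReal (∫ x, f x ∂μ) := by
    refine (lintegral_liminf_le' hmeas).trans
      (liminf_le_of_frequently_le' (Eventually.frequently ?_))
    filter_upwards [eventually_gt_atTop 0] with n hn
    rw [← ofReal_integral_eq_lintegral_ofReal (hpres.integrable_average hS hf n)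
      (ae_of_all _ (average_nonneg S n hf0)), hpres.integral_average hS hf hn]
  have hFtop : ∫⁻ x, F x ∂μ ≠ ∞ := (hle.trans_lt ENNReal.ofReal_lt_top).ne
  have hae := ae_lt_top' hFm hFtop
  refine ⟨fun x => (F x).toReal, integrable_toReal_of_lintegral_ne_top hFm hFtop, ?_, ?_⟩
  · rw [integral_toReal hFm hae]
    exact ENNReal.toReal_le_of_le_ofReal (integral_nonneg hf0) hle
  · filter_upwards [hae] with x hx
    exact isLiminf_toReal_liminf_ofReal (fun n => average_nonneg S n hf0 x) hx.ne

theorem PreservesMeasure.ergodicSum_of_koopman_eq (hpres : PreservesMeasure S μ)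
    {h : X → ℝ} (hh : koopman S h =ᵐ[μ] h) (n : ℕ) :
    ergodicSum S n h =ᵐ[μ] fun x => n * h x := by
  induction n with
  | zero => exact ae_of_all _ fun x => by simp
  | succ n ih =>
    have h1 := hpres.koopman_congr_ae ih
    have h2 : koopman S (fun x => n * h x) = (n : ℝ) • koopman S h :=
      map_smul (koopmanLinear S) (n : ℝ) h
    rw [ergodicSum_succ]
    filter_upwards [h1, hh] with x hx hx'
    rw [Pi.add_apply, hx, h2, Pi.smul_apply, hx', smul_eq_mul]
    push_cast
    ring

/-- The inferior limit of the ergodic averages of a nonnegative integrable function is invariant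
and has the same integral. -/
theorem PreservesMeasure.exists_isLiminf (hpres : PreservesMeasure S μ) [IsProbabilityMeasure μ]
    (hS : IsMTransformation m S) {f : X → ℝ} (hf : Integrable f μ) (hf0 : 0 ≤ f) :
    ∃ h : X → ℝ, Integrable h μ ∧ ∫ x, h x ∂μ = ∫ x, f x ∂μ ∧ koopman S h =ᵐ[μ] h ∧
      ∀ᵐ x ∂μ, IsLiminf (fun n => average S n f x) (h x) := by
  obtain ⟨h, hh, hle, hlim⟩ := hpres.exists_isLiminf_integral_le hS hf hf0
  have hPle : koopman S h ≤ᵐ[μ] h := by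
    filter_upwards [hlim, hpres.ae_forall_mem hlim] with x hx hx'
    exact koopman_le_of_isLiminf hS hx hx'
  have hP : koopman S h =ᵐ[μ] h :=
    (integral_eq_iff_of_ae_le (hpres.integrable_koopman hS hh) hh hPle).1
      (hpres.integral_koopman hh)
  refine ⟨h, hh, hle.antisymm (le_of_forall_pos_le_add fun ε hε => ?_), hP, hlim⟩
  -- As Uh = h, the n-th ergodic sum of this function is n (h + ε - A_n f) a.e., which is positive
  -- for some n. The maximal inequality therefore integrates over the whole space.
  have hg : Integrable (h + (fun _ => ε) - f) μ := (hh.add (integrable_const ε)).sub hf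
  have hpos :
      ({x | ∃ n, 0 < ergodicSum S n (h + (fun _ => ε) - f) x} : Set X) =ᵐ[μ] Set.univ := by
    rw [eventuallyEq_univ]
    filter_upwards [hlim, ae_all_iff.2 (hpres.ergodicSum_of_koopman_eq hP)] with x hx hsum
    obtain ⟨n, hn, hn0⟩ := ((hx ε hε).2.and_eventually (eventually_gt_atTop 0)).exists
    have hn' : (0 : ℝ) < n := by exact_mod_cast hn0
    refine ⟨n, ?_⟩
    simp only [average_eq_ergodicSum, div_lt_iff₀ hn'] at hn
    simp only [map_sub, map_add, ergodicSum_const hS, Pi.sub_apply, Pi.add_apply, hsum]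
    linarith
  have := hpres.setIntegral_exists_ergodicSum_pos_nonneg hS hg
  rw [setIntegral_congr_set hpos, setIntegral_univ,
    integral_sub' (hh.add (integrable_const ε)) hf, integral_add' hh (integrable_const ε)] at this
  simp only [integral_const, probReal_univ, smul_eq_mul, one_mul] at this
  linarith

end Liminf

/-! ### Pointwise convergence. -/

section Convergence

variable [MeasurableSpace X] {μ : Measure X} [IsProbabilityMeasure μ] {S : X → Finset X} {m : ℕ}

/-- If k is the liminf for c - f, then c - k is the limsup for f. It dominates the liminf h and has
the same integral, so the two agree a.e. -/
theorem PreservesMeasure.exists_tendsto_average_of_bounded (hpres : PreservesMeasure S μ)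
    (hS : IsMTransformation m S) {f : X → ℝ} (hf : Integrable f μ) (hf0 : 0 ≤ f) {c : ℝ}
    (hfc : ∀ x, f x ≤ c) :
    ∃ h : X → ℝ, ∀ᵐ x ∂μ, Tendsto (fun n => average S n f x) atTop (𝓝 (h x)) := by
  have hg : Integrable ((fun _ => c) - f) μ := (integrable_const c).sub hf
  obtain ⟨h, hh, hint, -, hlim⟩ := hpres.exists_isLiminf hS hf hf0
  obtain ⟨k, hk, kint, -, klim⟩ := hpres.exists_isLiminf hS hg fun x => sub_nonneg.2 (hfc x)
  have hsup : ∀ᵐ x ∂μ, ∀ ε > 0, (∀ᶠ n in atTop, average S n f x < c - k x + ε) := by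
    filter_upwards [klim] with x hx ε hε
    filter_upwards [(hx ε hε).1, eventually_gt_atTop 0] with n hn hn0
    rw [average_sub, average_const hS hn0] at hn
    linarith
  have hle : h ≤ᵐ[μ] (fun _ => c) - k := by
    filter_upwards [hsup, hlim] with x h1 h2
    refine le_of_forall_pos_le_add fun ε hε => ?_
    obtain ⟨n, hn, hn'⟩ := ((h1 (ε / 2) (half_pos hε)).and (h2 (ε / 2) (half_pos hε)).1).exists
    simp only [Pi.sub_apply]
    linarith
  have heq : h =ᵐ[μ] (fun _ => c) - k := by
    refine (integral_eq_iff_of_ae_le hh ((integrable_const c).sub hk) hle).1 ?_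
    rw [integral_sub' (integrable_const c) hk, kint, integral_sub' (integrable_const c) hf, hint]
    ring
  refine ⟨h, ?_⟩
  filter_upwards [hsup, hlim, heq] with x h1 h2 h3
  rw [tendsto_order]
  refine ⟨fun a ha => ?_, fun a ha => ?_⟩
  · filter_upwards [(h2 (h x - a) (sub_pos.2 ha)).1] with n hn
    linarith
  · filter_upwards [h1 (a - h x) (sub_pos.2 ha)] with n hn
    simp only [Pi.sub_apply] at h3
    linarith

/-- Averages of min(f, N) converge to a limit at most h, so failure of the bound forces some average
of the remainder `r N` above ε / 2. The weak-type inequality bounds the measure of such points by a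
multiple of ∫ `r N`, which tends to 0. -/
theorem PreservesMeasure.ae_eventually_average_lt (hpres : PreservesMeasure S μ)
    (hS : IsMTransformation m S) {f h : X → ℝ} (hf : Integrable f μ) (hf0 : 0 ≤ f)
    (hlim : ∀ᵐ x ∂μ, IsLiminf (fun n => average S n f x) (h x)) {ε : ℝ} (hε : 0 < ε) :
    ∀ᵐ x ∂μ, ∀ᶠ n in atTop, average S n f x < h x + ε := by
  set r : ℕ → X → ℝ := fun N x => f x - min (f x) N with hr
  have htr : ∀ N : ℕ, Integrable (fun x => min (f x) N) μ := fun N =>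
    hf.inf (integrable_const (N : ℝ))
  have hrint : ∀ N, Integrable (r N) μ := fun N => hf.sub (htr N)
  have hr0 : ∀ N, 0 ≤ r N := fun N x => sub_nonneg.2 (min_le_left _ _)
  have hbad : ∀ N, μ.real {x | ¬ ∀ᶠ n in atTop, average S n f x < h x + ε} ≤
      (∫ x, r N x ∂μ) / (ε / 2) := by
    intro N
    rw [le_div_iff₀ (half_pos hε), mul_comm]
    refine le_trans (mul_le_mul_of_nonneg_left ?_ (half_pos hε).le)
      (hpres.mul_measureReal_exists_average_gt_le hS (hrint N) (hr0 N) (ε / 2))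
    obtain ⟨k, hk⟩ := hpres.exists_tendsto_average_of_bounded hS (htr N)
      (fun x => le_min (hf0 x) (Nat.cast_nonneg N)) (fun x => min_le_right _ _)
    refine ENNReal.toReal_mono (measure_ne_top _ _) (measure_mono_ae ?_)
    filter_upwards [hk, hlim] with x hx hx' hxbad
    have hkh : k x ≤ h x := by
      refine le_of_forall_pos_le_add fun δ hδ => ?_
      obtain ⟨n, hn, hn'⟩ := ((hx' (δ / 2) (half_pos hδ)).2.and_eventually
        (hx.eventually_const_lt (by linarith : k x - δ / 2 < k x))).exists
      have := average_mono S n (f := fun x => min (f x) N) (g := f) (fun x => min_le_left _ _) x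
      linarith
    by_contra hcon
    refine hxbad ?_
    filter_upwards [hx.eventually_lt_const (by linarith : k x < h x + ε / 2),
      eventually_gt_atTop 0] with n hn hn0
    have h1 : average S n (r N) x ≤ ε / 2 := by
      by_contra! h2
      exact hcon ⟨n, hn0, h2⟩
    have h2 : average S n (r N) x = average S n f x - average S n (fun x => min (f x) N) x :=
      average_sub S n f _ x
    linarith
  have hlim0 : Tendsto (fun N => ∫ x, r N x ∂μ) atTop (𝓝 0) := by
    rw [← integral_zero X ℝ (μ := μ)]
    refine tendsto_integral_of_dominated_convergence f (fun N => (hrint N).1) hf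
      (fun N => ae_of_all _ fun x => ?_) (ae_of_all _ fun x => ?_)
    · rw [Real.norm_of_nonneg (hr0 N x)]
      have : 0 ≤ min (f x) N := le_min (hf0 x) (Nat.cast_nonneg N)
      simp only [hr]
      linarith
    · refine tendsto_const_nhds.congr' ?_
      filter_upwards [eventually_ge_atTop ⌈f x⌉₊] with N hN
      simp [hr, min_eq_left (Nat.ceil_le.1 hN)]
  rw [ae_iff, ← measureReal_eq_zero_iff]
  have := ge_of_tendsto' (hlim0.div_const (ε / 2)) hbad
  rw [zero_div] at this
  exact this.antisymm measureReal_nonneg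

/-- The pointwise ergodic theorem for nonnegative integrable functions. -/
theorem PreservesMeasure.exists_tendsto_average_of_nonneg (hpres : PreservesMeasure S μ)
    (hS : IsMTransformation m S) {f : X → ℝ} (hf : Integrable f μ) (hf0 : 0 ≤ f) :
    ∃ h : X → ℝ, Integrable h μ ∧
      (∀ᵐ x ∂μ, Tendsto (fun n => average S n f x) atTop (𝓝 (h x))) ∧
      koopman S h =ᵐ[μ] h ∧ ∫ x, h x ∂μ = ∫ x, f x ∂μ := by
  obtain ⟨h, hh, hint, hP, hlim⟩ := hpres.exists_isLiminf hS hf hf0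
  refine ⟨h, hh, ?_, hP, hint⟩
  -- Countably many tolerances allow one common null set.
  have hsup : ∀ᵐ x ∂μ, ∀ k : ℕ, ∀ᶠ n in atTop, average S n f x < h x + 1 / ((k : ℝ) + 1) :=
    ae_all_iff.2 fun k => hpres.ae_eventually_average_lt hS hf hf0 hlim Nat.one_div_pos_of_nat
  filter_upwards [hsup, hlim] with x h1 h2
  rw [tendsto_order]
  refine ⟨fun a ha => ?_, fun a ha => ?_⟩
  · filter_upwards [(h2 (h x - a) (sub_pos.2 ha)).1] with n hn
    linarith
  · obtain ⟨k, hk⟩ := exists_nat_one_div_lt (sub_pos.2 ha)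
    filter_upwards [h1 k] with n hn
    linarith

end Convergence

end MTransf

theorem mainTheorem2 {X : Type*} [MeasurableSpace X] (μ : Measure X) [IsProbabilityMeasure μ]
    (m : ℕ) (hm : 0 < m) (S : X → Finset X) (hS : MTransf.IsMTransformation m S)
    (hpres : MTransf.PreservesMeasure S μ) (f : X → ℝ) (hf : Integrable f μ) :
    ∃ fstar : X → ℝ, Integrable fstar μ ∧
      (∀ᵐ x ∂μ, Tendsto (fun n : ℕ => MTransf.average S n f x) atTop (𝓝 (fstar x))) ∧
      MTransf.koopman S fstar =ᵐ[μ] fstar ∧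
      ∫ x, fstar x ∂μ = ∫ x, f x ∂μ := by
  obtain ⟨h, hh, hlim, hP, hint⟩ := hpres.exists_tendsto_average_of_nonneg hS hf.pos_part
    fun x => le_max_right (f x) 0
  obtain ⟨k, hk, klim, kP, kint⟩ := hpres.exists_tendsto_average_of_nonneg hS hf.neg_part
    fun x => le_max_right (-f x) 0
  have hsub : f = (fun x => max (f x) 0) - fun x => max (-f x) 0 := by
    funext x
    exact (max_zero_sub_eq_self (f x)).symm
  refine ⟨h - k, hh.sub hk, ?_, ?_, ?_⟩
  · filter_upwards [hlim, klim] with x hx hx'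
    have := hx.sub hx'
    simp only [← MTransf.average_sub, ← hsub] at this
    exact this
  · rw [MTransf.koopman_sub]
    exact hP.sub kP
  · rw [integral_sub' hh hk, hint, kint, ← integral_sub hf.pos_part hf.neg_part]
    exact integral_congr_ae (ae_of_all _ fun x => max_zero_sub_eq_self (f x))
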